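/- Let $I\in\{\tfrac12,1,\tfrac32,\dots\}$ be a nuclear spin and let $\mathcal H=\mathbb C^2\otimes\mathbb C^{2I+1}$ be the electronic ground state space of an alkali atom, i.e. the tensor product of an electron spin $S=\tfrac12$ and the nuclear spin $I$, of dimension $d=2(2I+1)$. Let $F_a=S_a\otimes 1+1\otimes I_a$ $(a=x,y,z)$ be the total angular momentum operators (with $\hbar=1$), where $S_a$ and $I_a$ are the standard spin-$\tfrac12$ and spin-$I$ operators, and let $F^2=F_x^2+F_y^2+F_z^2$. Put $F_\pm=I\pm\tfrac12$, let $P_\pm$ be the orthogonal projection onto the eigenspace of $F^2$ with eigenvalue $F_\pm(F_\pm+1)$ (the two hyperfine manifolds), and let $F_a^{(\pm)}=P_\pm F_aP_\pm$. Choose any $m_+\in\{-F_+,-F_++1,\dots,F_+\}$ and any $m_-\in\{-F_-,-F_-+1,\dots,F_-\}$, and let $|F_\pm,m_\pm\rangle$ be a unit vector in the range of $P_\pm$ with $F_z|F_\pm,m_\pm\rangle=m_\pm|F_\pm,m_\pm\rangle$. Set $$\sigma_x=|F_+,m_+\rangle\langle F_-,m_-|+|F_-,m_-\rangle\langle F_+,m_+|,\qquad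 \sigma_y=-i|F_+,m_+\rangle\langle F_-,m_-|+i|F_-,m_-\rangle\langle F_+,m_+|.$$ Then the six operators $F_x^{(+)},F_y^{(+)},F_x^{(-)},F_y^{(-)},\sigma_x,\sigma_y$ generate all of $\mathfrak{su}(d)=\mathfrak{su}(2(2I+1))$: the smallest real Lie algebra of operators on $\mathcal H$ (closed under real linear combinations and commutators) that contains $-iH$ for each of the six operators $H$ is the Lie algebra of all traceless skew-Hermitian operators on $\mathcal H$. -/

import Mathlib

open scoped Matrix Kronecker

-- Matrices are a Lie ring under the commutator.
attribute [local instance 100] LieRing.ofAssociativeRing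

noncomputable section

namespace AlkaliControl

/-! Spins are given by their doubled quantum number: `n : ℕ` stands for the spin `n / 2`. The basis
vector `k : Fin (n + 1)` of the spin-`n / 2` space is the eigenvector of `J_z` with magnetic
quantum number `m = n / 2 - k`. -/

/-- The magnetic quantum number of the basis vector `k` of a spin `n / 2`. -/
def magnetic (n : ℕ) (k : Fin (n + 1)) : ℝ := (n : ℝ) / 2 - (k : ℕ)

/-- The matrix of `J_z` for spin `n / 2`. -/
def spinZ (n : ℕ) : Matrix (Fin (n + 1)) (Fin (n + 1)) ℂ :=
  Matrix.diagonal fun k => (magnetic n k : ℂ)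

/-- The raising operator `J_+ |j, m⟩ = √(j (j + 1) - m (m + 1)) |j, m + 1⟩` for spin `j = n / 2`. -/
def spinRaise (n : ℕ) : Matrix (Fin (n + 1)) (Fin (n + 1)) ℂ :=
  Matrix.of fun a b =>
    if (a : ℕ) + 1 = (b : ℕ) then
      ((Real.sqrt ((n : ℝ) / 2 * ((n : ℝ) / 2 + 1) - magnetic n b * (magnetic n b + 1)) : ℝ) : ℂ)
    else 0

/-- `J_x = (J_+ + J_-) / 2` for spin `n / 2`. -/
def spinX (n : ℕ) : Matrix (Fin (n + 1)) (Fin (n + 1)) ℂ :=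
  (1 / 2 : ℂ) • (spinRaise n + (spinRaise n)ᴴ)

/-- `J_y = (J_+ - J_-) / (2 i)` for spin `n / 2`. -/
def spinY (n : ℕ) : Matrix (Fin (n + 1)) (Fin (n + 1)) ℂ :=
  (1 / (2 * Complex.I)) • (spinRaise n - (spinRaise n)ᴴ)

/-- Index of the product basis of the electronic ground state of an alkali atom: electron spin
`1 / 2` tensor nuclear spin `I = n / 2`, of dimension `2 (2 I + 1) = 2 (n + 1)`. -/
abbrev Idx (n : ℕ) : Type := Fin 2 × Fin (n + 1)

/-- Operators on the electronic ground state, as matrices in the product basis. -/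
abbrev Op (n : ℕ) : Type := Matrix (Idx n) (Idx n) ℂ

/-- Total angular momentum `F_x = S_x ⊗ 1 + 1 ⊗ I_x`. -/
def totalX (n : ℕ) : Op n := spinX 1 ⊗ₖ 1 + 1 ⊗ₖ spinX n

/-- Total angular momentum `F_y = S_y ⊗ 1 + 1 ⊗ I_y`. -/
def totalY (n : ℕ) : Op n := spinY 1 ⊗ₖ 1 + 1 ⊗ₖ spinY n

/-- Total angular momentum `F_z = S_z ⊗ 1 + 1 ⊗ I_z`. -/
def totalZ (n : ℕ) : Op n := spinZ 1 ⊗ₖ 1 + 1 ⊗ₖ spinZ n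

/-- The Casimir operator `F² = F_x² + F_y² + F_z²`. -/
def totalSq (n : ℕ) : Op n := totalX n ^ 2 + totalY n ^ 2 + totalZ n ^ 2

/-- The quantum number `F_+ = I + 1 / 2` of the upper hyperfine manifold. -/
def upperF (n : ℕ) : ℝ := (n : ℝ) / 2 + 1 / 2

/-- The quantum number `F_- = I - 1 / 2` of the lower hyperfine manifold. -/
def lowerF (n : ℕ) : ℝ := (n : ℝ) / 2 - 1 / 2

/-- The manifold with quantum number `f`: the eigenspace of `F²` with eigenvalue `f (f + 1)`. -/
def manifold (n : ℕ) (f : ℝ) : Submodule ℂ (EuclideanSpace ℂ (Idx n)) :=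
  Module.End.eigenspace (Matrix.toEuclideanLin (totalSq n)) ((f * (f + 1) : ℝ) : ℂ)

/-- The orthogonal projection onto the manifold with quantum number `f`. -/
def manifoldProj (n : ℕ) (f : ℝ) : Op n :=
  (Matrix.toEuclideanCLM (n := Idx n) (𝕜 := ℂ)).symm (manifold n f).starProjection

/-- The operator `A` projected onto the manifold with quantum number `f`: `P_f A P_f`. -/
def projected (n : ℕ) (f : ℝ) (A : Op n) : Op n := manifoldProj n f * A * manifoldProj n f

/-- `ψ` is a magnetic sublevel `|f, m⟩`: a unit vector of the manifold with quantum number `f`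
that is an eigenvector of `F_z` with eigenvalue `m`. This fixes `ψ` up to a phase. -/
structure IsSublevel (n : ℕ) (f m : ℝ) (ψ : EuclideanSpace ℂ (Idx n)) : Prop where
  norm_eq_one : ‖ψ‖ = 1
  mem_manifold : ψ ∈ manifold n f
  totalZ_eq : Matrix.toEuclideanLin (totalZ n) ψ = (m : ℂ) • ψ

/-- The operator `|φ⟩⟨ψ|`. -/
def ketBra {n : ℕ} (φ ψ : EuclideanSpace ℂ (Idx n)) : Op n :=
  Matrix.vecMulVec φ.ofLp (star ψ.ofLp)

/-- The Pauli operator `σ_x = |φ⟩⟨ψ| + |ψ⟩⟨φ|` of the pseudospin with states `φ` and `ψ`. -/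
def pauliX {n : ℕ} (φ ψ : EuclideanSpace ℂ (Idx n)) : Op n := ketBra φ ψ + ketBra ψ φ

/-- The Pauli operator `σ_y = -i |φ⟩⟨ψ| + i |ψ⟩⟨φ|` of the pseudospin with states `φ` and `ψ`. -/
def pauliY {n : ℕ} (φ ψ : EuclideanSpace ℂ (Idx n)) : Op n :=
  -Complex.I • ketBra φ ψ + Complex.I • ketBra ψ φ

/-- The real Lie algebra `𝔰𝔲(ι)` of traceless skew-Hermitian matrices. -/
def su (ι : Type) [Fintype ι] [DecidableEq ι] : LieSubalgebra ℝ (Matrix ι ι ℂ) where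
  carrier := {A | Aᴴ = -A ∧ A.trace = 0}
  add_mem' := by
    rintro A B ⟨hA, hA'⟩ ⟨hB, hB'⟩
    exact ⟨by rw [Matrix.conjTranspose_add, hA, hB]; abel, by rw [Matrix.trace_add, hA', hB', add_zero]⟩
  zero_mem' := by simp
  smul_mem' := by
    rintro c A ⟨hA, hA'⟩
    exact ⟨by rw [Matrix.conjTranspose_smul, hA]; simp, by rw [Matrix.trace_smul, hA', smul_zero]⟩
  lie_mem' := by
    rintro A B ⟨hA, _⟩ ⟨hB, _⟩
    refine ⟨?_, ?_⟩
    · rw [Ring.lie_def, Matrix.conjTranspose_sub, Matrix.conjTranspose_mul,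
        Matrix.conjTranspose_mul, hA, hB]
      noncomm_ring
    · rw [Ring.lie_def, Matrix.trace_sub, Matrix.trace_mul_comm, sub_self]

/-- The control algebra of a set of Hermitian operators `H`: the real Lie algebra generated by the
skew-Hermitian operators `-i H`, that is, the closure under real linear combinations and
commutators. -/
def controlAlgebra {n : ℕ} (S : Set (Op n)) : LieSubalgebra ℝ (Op n) :=
  LieSubalgebra.lieSpan ℝ (Op n) ((fun H => -Complex.I • H) '' S)

end AlkaliControl

end

noncomputable section

namespace AlkaliControl

/-! ### Commutation relations of the spin operators -/

/-! All generators are traceless and Hermitian, which gives one inclusion. For the other, pass to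
the complexification `L + iL`, where `σ_x + i σ_y` yields the single transition `|φ⟩⟨ψ|`. Since
`F_a^{(+)}` kills the lower manifold and `F_a^{(-)}` the upper one, commutators with them move the
ket and the bra independently. Both manifolds are irreducible under `F_x, F_y`, so every `|a⟩⟨b|`
from lower to upper manifold is reached (`ketBra_upper_lower_mem`). Adjoints and brackets of these
operators produce every traceless operator (`traceless_mem_complexified`), and a skew-Hermitian
element of `L + iL` lies in `L`.

Irreducibility needs no Clebsch–Gordan basis. The raising operator is nilpotent, so a nonzero
invariant subspace contains a highest weight vector. Solving `F_+ u = 0` in the product basis and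
comparing Casimir eigenvalues shows that each manifold has at most one such vector up to scale,
whereas a proper nonzero invariant subspace and its orthogonal complement in the manifold would
supply two orthogonal ones (`irreducible_of_highest`). The same description of highest weight
vectors shows that the manifolds span the space (`manifold_sup_eq_top`). -/

lemma spinRaise_apply (n : ℕ) (a b : Fin (n + 1)) :
    spinRaise n a b = if (a : ℕ) + 1 = (b : ℕ) then
      ((Real.sqrt ((b : ℕ) * ((n : ℝ) + 1 - (b : ℕ))) : ℝ) : ℂ) else 0 := by
  simp only [spinRaise, magnetic, Matrix.of_apply]
  congr 4
  ring

lemma sqrt_ladder_mul_self (n : ℕ) (b : Fin (n + 1)) :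
    ((Real.sqrt ((b : ℕ) * ((n : ℝ) + 1 - (b : ℕ))) : ℝ) : ℂ) *
      ((Real.sqrt ((b : ℕ) * ((n : ℝ) + 1 - (b : ℕ))) : ℝ) : ℂ) =
      (b : ℕ) * ((n : ℂ) + 1 - (b : ℕ)) := by
  have hb : ((b : ℕ) : ℝ) ≤ n := by exact_mod_cast Nat.lt_succ_iff.mp b.isLt
  have h : (0 : ℝ) ≤ (b : ℕ) * ((n : ℝ) + 1 - (b : ℕ)) :=
    mul_nonneg (Nat.cast_nonneg _) (by linarith)
  rw [← Complex.ofReal_mul, Real.mul_self_sqrt h]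
  push_cast
  ring

lemma spinRaise_mul_conjTranspose (n : ℕ) :
    spinRaise n * (spinRaise n)ᴴ =
      Matrix.diagonal fun a : Fin (n + 1) => (((a : ℕ) : ℂ) + 1) * ((n : ℂ) - (a : ℕ)) := by
  ext a b
  simp only [Matrix.mul_apply, Matrix.conjTranspose_apply, spinRaise_apply, Matrix.diagonal_apply]
  by_cases ha : (a : ℕ) + 1 < n + 1
  · rw [Finset.sum_eq_single (⟨a + 1, ha⟩ : Fin (n + 1))]
    · by_cases hab : a = b
      · subst hab
        have := sqrt_ladder_mul_self n ⟨a + 1, ha⟩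
        simp only [if_true, RCLike.star_def, Complex.conj_ofReal]
        rw [this]
        push_cast
        ring
      · have : (b : ℕ) ≠ a := fun h => hab (Fin.ext h.symm)
        simp [hab, this]
    · intro c _ hc
      have : ¬ (a : ℕ) + 1 = c := fun h => hc (Fin.ext h.symm)
      simp [this]
    · simp
  -- The last row of `J_+` is zero, in agreement with the factor `n - a`.
  · have han : (a : ℕ) = n := by omega
    rw [Finset.sum_eq_zero]
    · simp [han]
    · intro c _
      have : ¬ (a : ℕ) + 1 = c := by omega
      simp [this]

lemma spinRaise_conjTranspose_mul (n : ℕ) :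
    (spinRaise n)ᴴ * spinRaise n =
      Matrix.diagonal fun a : Fin (n + 1) => ((a : ℕ) : ℂ) * ((n : ℂ) + 1 - (a : ℕ)) := by
  ext a b
  simp only [Matrix.mul_apply, Matrix.conjTranspose_apply, spinRaise_apply, Matrix.diagonal_apply]
  by_cases ha : 0 < (a : ℕ)
  · rw [Finset.sum_eq_single (⟨a - 1, by omega⟩ : Fin (n + 1))]
    · by_cases hab : a = b
      · subst hab
        have h1 : (a : ℕ) - 1 + 1 = a := by omega
        simp only [h1, if_true, RCLike.star_def, Complex.conj_ofReal]
        exact sqrt_ladder_mul_self n a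
      · have h1 : (a : ℕ) - 1 + 1 = a := by omega
        have : (a : ℕ) ≠ b := fun h => hab (Fin.ext h)
        simp [hab, this, h1]
    · intro c _ hc
      have : ¬ (c : ℕ) + 1 = a := fun h => hc (Fin.ext (by simp; omega))
      simp [this]
    · simp
  · have han : (a : ℕ) = 0 := by omega
    rw [Finset.sum_eq_zero]
    · simp [han]
    · intro c _
      have : ¬ (c : ℕ) + 1 = a := by omega
      simp [this]

lemma spinRaise_commutator (n : ℕ) :
    spinRaise n * (spinRaise n)ᴴ - (spinRaise n)ᴴ * spinRaise n = (2 : ℂ) • spinZ n := by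
  rw [spinRaise_mul_conjTranspose, spinRaise_conjTranspose_mul, spinZ, Matrix.diagonal_sub,
    ← Matrix.diagonal_smul]
  congr 1
  ext a
  simp only [magnetic, Pi.smul_apply, smul_eq_mul]
  push_cast
  ring

lemma spinZ_commutator (n : ℕ) :
    spinZ n * spinRaise n - spinRaise n * spinZ n = spinRaise n := by
  ext a b
  rw [Matrix.sub_apply, spinZ, Matrix.diagonal_mul, Matrix.mul_diagonal, spinRaise_apply]
  split_ifs with h
  · simp only [magnetic, ← h]
    push_cast
    ring
  · simp

lemma spinZ_conjTranspose (n : ℕ) : (spinZ n)ᴴ = spinZ n := by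
  rw [spinZ, Matrix.diagonal_conjTranspose]
  congr 1
  ext a
  simp

/-! ### Commutation relations of the total angular momentum -/

/-- The raising operator of the total angular momentum. -/
def totalRaise (n : ℕ) : Op n := spinRaise 1 ⊗ₖ 1 + 1 ⊗ₖ spinRaise n

/-- The cross terms cancel because `A ⊗ 1` commutes with `1 ⊗ B'`; hence the total angular momentum
inherits the relations of its two factors. -/
lemma kronecker_sum_commutator {p q : Type*} [Fintype p] [Fintype q] [DecidableEq p]
    [DecidableEq q] (A A' : Matrix p p ℂ) (B B' : Matrix q q ℂ) :
    (A ⊗ₖ (1 : Matrix q q ℂ) + (1 : Matrix p p ℂ) ⊗ₖ B) *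
        (A' ⊗ₖ (1 : Matrix q q ℂ) + (1 : Matrix p p ℂ) ⊗ₖ B') -
      (A' ⊗ₖ (1 : Matrix q q ℂ) + (1 : Matrix p p ℂ) ⊗ₖ B') *
        (A ⊗ₖ (1 : Matrix q q ℂ) + (1 : Matrix p p ℂ) ⊗ₖ B) =
      (A * A' - A' * A) ⊗ₖ (1 : Matrix q q ℂ) + (1 : Matrix p p ℂ) ⊗ₖ (B * B' - B' * B) := by
  simp only [mul_add, add_mul, ← Matrix.mul_kronecker_mul, Matrix.mul_one, Matrix.one_mul,
    sub_eq_add_neg, Matrix.add_kronecker, Matrix.kronecker_add, ← neg_one_smul ℂ (_ * _),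
    Matrix.smul_kronecker, Matrix.kronecker_smul]
  simp only [neg_one_smul]
  abel

lemma totalRaise_conjTranspose (n : ℕ) :
    (totalRaise n)ᴴ = (spinRaise 1)ᴴ ⊗ₖ 1 + 1 ⊗ₖ (spinRaise n)ᴴ := by
  simp [totalRaise, Matrix.conjTranspose_add, Matrix.conjTranspose_kronecker]

lemma totalZ_conjTranspose (n : ℕ) : (totalZ n)ᴴ = totalZ n := by
  simp [totalZ, Matrix.conjTranspose_add, Matrix.conjTranspose_kronecker, spinZ_conjTranspose]

lemma totalRaise_commutator (n : ℕ) :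
    totalRaise n * (totalRaise n)ᴴ - (totalRaise n)ᴴ * totalRaise n = (2 : ℂ) • totalZ n := by
  rw [totalRaise_conjTranspose, totalRaise, kronecker_sum_commutator, spinRaise_commutator,
    spinRaise_commutator, totalZ, Matrix.smul_kronecker, Matrix.kronecker_smul, smul_add]

lemma totalZ_commutator (n : ℕ) :
    totalZ n * totalRaise n - totalRaise n * totalZ n = totalRaise n := by
  rw [totalRaise, totalZ, kronecker_sum_commutator, spinZ_commutator, spinZ_commutator]

lemma totalX_eq (n : ℕ) : totalX n = (1 / 2 : ℂ) • (totalRaise n + (totalRaise n)ᴴ) := by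
  rw [totalRaise_conjTranspose, totalRaise, totalX, spinX, spinX, Matrix.smul_kronecker,
    Matrix.kronecker_smul, Matrix.add_kronecker, Matrix.kronecker_add, ← smul_add]
  congr 1
  abel

lemma totalY_eq (n : ℕ) :
    totalY n = (1 / (2 * Complex.I)) • (totalRaise n - (totalRaise n)ᴴ) := by
  rw [totalRaise_conjTranspose, totalRaise, totalY, spinY, spinY, Matrix.smul_kronecker,
    Matrix.kronecker_smul, sub_eq_add_neg (spinRaise 1), sub_eq_add_neg (spinRaise n),
    Matrix.add_kronecker, Matrix.kronecker_add, ← smul_add,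
    ← neg_one_smul ℂ (spinRaise 1)ᴴ, ← neg_one_smul ℂ (spinRaise n)ᴴ,
    Matrix.smul_kronecker, Matrix.kronecker_smul, neg_one_smul, neg_one_smul]
  congr 1
  abel

lemma totalX_conjTranspose (n : ℕ) : (totalX n)ᴴ = totalX n := by
  rw [totalX_eq, Matrix.conjTranspose_smul, Matrix.conjTranspose_add,
    Matrix.conjTranspose_conjTranspose, add_comm]
  simp

lemma totalY_conjTranspose (n : ℕ) : (totalY n)ᴴ = totalY n := by
  rw [totalY_eq, Matrix.conjTranspose_smul, Matrix.conjTranspose_sub,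
    Matrix.conjTranspose_conjTranspose, ← neg_sub, smul_neg, ← neg_smul]
  congr 1
  simp

lemma totalRaise_eq (n : ℕ) : totalRaise n = totalX n + Complex.I • totalY n := by
  rw [totalX_eq, totalY_eq, smul_smul]
  have : Complex.I * (1 / (2 * Complex.I)) = 1 / 2 := by field_simp
  rw [this]
  module

lemma totalRaise_conjTranspose_eq (n : ℕ) :
    (totalRaise n)ᴴ = totalX n - Complex.I • totalY n := by
  rw [totalRaise_eq, Matrix.conjTranspose_add, Matrix.conjTranspose_smul, totalX_conjTranspose,
    totalY_conjTranspose]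
  simp [sub_eq_add_neg]

lemma totalZ_eq_commutator (n : ℕ) :
    totalZ n = -Complex.I • (totalX n * totalY n - totalY n * totalX n) := by
  have h := totalRaise_commutator n
  rw [totalRaise_conjTranspose_eq, totalRaise_eq] at h
  have h2 : totalZ n = (1 / 2 : ℂ) • ((2 : ℂ) • totalZ n) := by module
  rw [h2, ← h]
  simp only [mul_add, add_mul, mul_sub, sub_mul, smul_mul_assoc, mul_smul_comm]
  module

/-- With the raising operator on the right, the first term vanishes on highest weight vectors. -/
lemma totalSq_eq (n : ℕ) :
    totalSq n = (totalRaise n)ᴴ * totalRaise n + totalZ n * totalZ n + totalZ n := by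
  have h : (totalX n ^ 2 + totalY n ^ 2 : Op n) =
      (totalRaise n)ᴴ * totalRaise n + totalZ n := by
    have hz := totalZ_eq_commutator n
    rw [hz, totalRaise_conjTranspose_eq, totalRaise_eq]
    simp only [mul_add, sub_mul, smul_mul_assoc, mul_smul_comm, smul_sub, smul_smul,
      Complex.I_mul_I, sq, neg_smul, one_smul]
    abel
  rw [totalSq, h, sq]
  abel

lemma totalZ_commutator_conjTranspose (n : ℕ) :
    totalZ n * (totalRaise n)ᴴ - (totalRaise n)ᴴ * totalZ n = -(totalRaise n)ᴴ := by
  have h := congrArg Matrix.conjTranspose (totalZ_commutator n)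
  rw [Matrix.conjTranspose_sub, Matrix.conjTranspose_mul, Matrix.conjTranspose_mul,
    totalZ_conjTranspose] at h
  rw [← neg_sub, h]

lemma totalSq_conjTranspose (n : ℕ) : (totalSq n)ᴴ = totalSq n := by
  rw [totalSq_eq]
  simp [totalZ_conjTranspose]

lemma totalRaise_commute_totalSq (n : ℕ) : Commute (totalRaise n) (totalSq n) := by
  have h1 := totalRaise_commutator n
  have h2 := totalZ_commutator n
  rw [Commute, SemiconjBy, totalSq_eq, ← sub_eq_zero]
  set R := totalRaise n
  set Z := totalZ n
  -- Leibniz rule: with `[R, Rᴴ] = 2Z` and `[Z, R] = R` the right side becomes `2ZR - RZ - ZR - R =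
  -- [Z, R] - R = 0`.
  have h3 : R * (Rᴴ * R + Z * Z + Z) - (Rᴴ * R + Z * Z + Z) * R =
      (R * Rᴴ - Rᴴ * R) * R - (Z * R - R * Z) * Z - Z * (Z * R - R * Z) - (Z * R - R * Z) := by
    noncomm_ring
  rw [h3, h1, h2]
  have h4 : (2 : ℂ) • Z * R - R * Z - Z * R - R = (Z * R - R * Z) - R := by
    rw [smul_mul_assoc, two_smul]
    abel
  rw [h4, h2, sub_self]

lemma totalRaise_conjTranspose_commute_totalSq (n : ℕ) :
    Commute (totalRaise n)ᴴ (totalSq n) := by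
  have h := congrArg Matrix.conjTranspose (totalRaise_commute_totalSq n).eq
  rw [Matrix.conjTranspose_mul, Matrix.conjTranspose_mul, totalSq_conjTranspose] at h
  exact h.symm

lemma totalX_commute_totalSq (n : ℕ) : Commute (totalX n) (totalSq n) := by
  rw [totalX_eq]
  exact ((totalRaise_commute_totalSq n).add_left
    (totalRaise_conjTranspose_commute_totalSq n)).smul_left _

lemma totalY_commute_totalSq (n : ℕ) : Commute (totalY n) (totalSq n) := by
  rw [totalY_eq]
  exact ((totalRaise_commute_totalSq n).sub_left
    (totalRaise_conjTranspose_commute_totalSq n)).smul_left _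

/-! ### Highest weight vectors -/

lemma toEuclideanLin_mul_apply {ι : Type*} [Fintype ι] [DecidableEq ι] (A B : Matrix ι ι ℂ)
    (v : EuclideanSpace ℂ ι) :
    Matrix.toEuclideanLin (A * B) v = Matrix.toEuclideanLin A (Matrix.toEuclideanLin B v) := by
  simp [Matrix.toLpLin_apply, Matrix.mulVec_mulVec]

lemma inner_toEuclideanLin {ι : Type*} [Fintype ι] [DecidableEq ι] (A : Matrix ι ι ℂ)
    (u v : EuclideanSpace ℂ ι) :
    inner ℂ (Matrix.toEuclideanLin A u) v = inner ℂ u (Matrix.toEuclideanLin Aᴴ v) := by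
  rw [Matrix.toEuclideanLin_conjTranspose_eq_adjoint, LinearMap.adjoint_inner_right]

/-- The eigenvalue of `F_z` on a vector of the product basis. -/
def weight (n : ℕ) (i : Idx n) : ℝ := magnetic 1 i.1 + magnetic n i.2

lemma totalZ_eq_diagonal (n : ℕ) :
    totalZ n = Matrix.diagonal fun i => (weight n i : ℂ) := by
  ext i j
  rcases eq_or_ne i j with rfl | hij
  · simp [totalZ, spinZ, weight]
  · by_cases h1 : i.1 = j.1
    · have h2 : i.2 ≠ j.2 := fun h2 => hij (Prod.ext h1 h2)
      simp [totalZ, spinZ, h2, hij, Matrix.diagonal_apply_ne]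
    · simp [totalZ, spinZ, h1, hij, Matrix.diagonal_apply_ne]

lemma totalRaise_apply (n : ℕ) (i j : Idx n) :
    totalRaise n i j = spinRaise 1 i.1 j.1 * (1 : Matrix (Fin (n + 1)) (Fin (n + 1)) ℂ) i.2 j.2 +
      (1 : Matrix (Fin 2) (Fin 2) ℂ) i.1 j.1 * spinRaise n i.2 j.2 := rfl

/-- `i.1 + i.2` counts the steps of the weight below its maximum, and raising lowers this count by
one. The count runs from `0` to `n + 1`, whence nilpotency of order `n + 2`. -/
lemma totalRaise_apply_eq_zero (n : ℕ) (i j : Idx n)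
    (h : (i.1 : ℕ) + i.2 + 1 ≠ (j.1 : ℕ) + j.2) : totalRaise n i j = 0 := by
  rw [totalRaise_apply, spinRaise_apply, spinRaise_apply, Matrix.one_apply, Matrix.one_apply]
  split_ifs with h1 h2 h3 h4 h5 <;> simp_all <;> omega

lemma totalRaise_pow_apply_eq_zero (n N : ℕ) (i j : Idx n)
    (h : (i.1 : ℕ) + i.2 + N ≠ (j.1 : ℕ) + j.2) : (totalRaise n ^ N) i j = 0 := by
  induction N generalizing j with
  | zero =>
    rw [pow_zero, Matrix.one_apply_ne]
    rintro rfl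
    exact h (by simp)
  | succ N ih =>
    rw [pow_succ, Matrix.mul_apply]
    refine Finset.sum_eq_zero fun c _ => ?_
    by_cases hc : (i.1 : ℕ) + i.2 + N = (c.1 : ℕ) + c.2
    · rw [totalRaise_apply_eq_zero n c j (by omega), mul_zero]
    · rw [ih c hc, zero_mul]

lemma totalRaise_pow_eq_zero (n : ℕ) : totalRaise n ^ (n + 2) = 0 := by
  ext i j
  exact totalRaise_pow_apply_eq_zero n _ i j (by omega)

/-- A nonzero subspace invariant under the raising operator contains a highest weight vector. -/
lemma exists_highest (n : ℕ) (U : Submodule ℂ (EuclideanSpace ℂ (Idx n))) (hU : U ≠ ⊥)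
    (h : ∀ v ∈ U, Matrix.toEuclideanLin (totalRaise n) v ∈ U) :
    ∃ u ∈ U, u ≠ 0 ∧ Matrix.toEuclideanLin (totalRaise n) u = 0 := by
  obtain ⟨v, hv, hv0⟩ := U.ne_bot_iff.mp hU
  have hex : ∃ N, Matrix.toEuclideanLin (totalRaise n ^ N) v = 0 :=
    ⟨n + 2, by rw [totalRaise_pow_eq_zero]; simp⟩
  have hmem : ∀ N, Matrix.toEuclideanLin (totalRaise n ^ N) v ∈ U := by
    intro N
    induction N with
    | zero => simpa [Matrix.toLpLin_apply] using hv
    | succ N ih =>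
      rw [pow_succ', toEuclideanLin_mul_apply]
      exact h _ ih
  classical
  -- The least power that kills `v` is positive since `v ≠ 0`; one power less gives the highest
  -- weight vector.
  obtain ⟨N, hN⟩ : ∃ N, Nat.find hex = N + 1 := by
    refine Nat.exists_eq_succ_of_ne_zero fun h0 => hv0 ?_
    have := Nat.find_spec hex
    rw [h0] at this
    simpa [Matrix.toLpLin_apply] using this
  refine ⟨_, hmem N, Nat.find_min hex (by omega), ?_⟩
  rw [← toEuclideanLin_mul_apply, ← pow_succ', ← hN]
  exact Nat.find_spec hex

lemma spinRaise_mulVec_castSucc (n : ℕ) (w : Fin (n + 1) → ℂ) (k : Fin n) :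
    ∃ c : ℂ, c ≠ 0 ∧ ∑ j, spinRaise n k.castSucc j * w j = c * w k.succ := by
  refine ⟨spinRaise n k.castSucc k.succ, ?_, ?_⟩
  · rw [spinRaise_apply, if_pos (by simp)]
    have hk : ((k : ℕ) : ℝ) < n := by exact_mod_cast k.isLt
    have : 0 < ((k.succ : ℕ) : ℝ) * ((n : ℝ) + 1 - (k.succ : ℕ)) := by
      rw [Fin.val_succ]
      push_cast
      exact mul_pos (by positivity) (by linarith)
    exact_mod_cast (Real.sqrt_pos.mpr this).ne'
  · refine Finset.sum_eq_single _ (fun j _ hj => ?_) (by simp)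
    rw [spinRaise_apply, if_neg, zero_mul]
    intro h
    exact hj (Fin.ext (by simpa using h.symm))

lemma totalRaise_apply_zero (n : ℕ) (u : EuclideanSpace ℂ (Idx n)) (k : Fin (n + 1)) :
    Matrix.toEuclideanLin (totalRaise n) u (0, k) =
      u (1, k) + ∑ j, spinRaise n k j * u (0, j) := by
  have h : (spinRaise 1 0 1 : ℂ) = 1 := by
    rw [spinRaise_apply]
    norm_num
  have h' : (spinRaise 1 0 0 : ℂ) = 0 := by
    rw [spinRaise_apply]
    norm_num
  simp [Matrix.toLpLin_apply, Matrix.mulVec, dotProduct, Fintype.sum_prod_type,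
    totalRaise_apply, h, h', Matrix.one_apply, add_comm]

lemma totalRaise_apply_one (n : ℕ) (u : EuclideanSpace ℂ (Idx n)) (k : Fin (n + 1)) :
    Matrix.toEuclideanLin (totalRaise n) u (1, k) = ∑ j, spinRaise n k j * u (1, j) := by
  have h : (spinRaise 1 1 1 : ℂ) = 0 := by
    rw [spinRaise_apply]
    norm_num
  have h' : (spinRaise 1 1 0 : ℂ) = 0 := by
    rw [spinRaise_apply]
    norm_num
  simp [Matrix.toLpLin_apply, Matrix.mulVec, dotProduct, Fintype.sum_prod_type,
    totalRaise_apply, h, h', Matrix.one_apply]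

section Highest

variable {n : ℕ} {u : EuclideanSpace ℂ (Idx n)}

/-- Split `u` by electron spin into `u₀, u₁`. Then `F_+ u = 0` means `J_+ u₁ = 0` and `u₁ + J_+ u₀ =
0`; the first equation leaves only the top entry of `u₁`. -/
lemma highest_one_succ (hu : Matrix.toEuclideanLin (totalRaise n) u = 0) (k : Fin n) :
    u (1, k.succ) = 0 := by
  have h := totalRaise_apply_one n u k.castSucc
  obtain ⟨c, hc, hs⟩ := spinRaise_mulVec_castSucc n (fun j => u (1, j)) k
  rw [hu, hs] at h
  simpa [hc] using h.symm

/-- In these rows of `u₁ + J_+ u₀ = 0` the `u₁` term is already zero. Row `0` is different: it ties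
`u (0, 1)` to `u (1, 0)` and leaves room for the highest weight vector of weight `F_-`. -/
lemma highest_zero_succ (hu : Matrix.toEuclideanLin (totalRaise n) u = 0) (k : Fin n)
    (hk : (k : ℕ) ≠ 0) : u (0, k.succ) = 0 := by
  have h := totalRaise_apply_zero n u k.castSucc
  obtain ⟨c, hc, hs⟩ := spinRaise_mulVec_castSucc n (fun j => u (0, j)) k
  obtain ⟨j, hj⟩ : ∃ j : Fin n, k.castSucc = j.succ :=
    ⟨⟨k - 1, by omega⟩, Fin.ext (by simp; omega)⟩
  rw [hu, hs, hj, highest_one_succ hu] at h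
  simpa [hc] using h.symm

lemma highest_one_zero (hu : Matrix.toEuclideanLin (totalRaise n) u = 0) (k : Fin n)
    (hk : (k : ℕ) = 0) (h0 : u (0, k.succ) = 0) : u (1, 0) = 0 := by
  have h := totalRaise_apply_zero n u k.castSucc
  obtain ⟨c, hc, hs⟩ := spinRaise_mulVec_castSucc n (fun j => u (0, j)) k
  have hj : k.castSucc = 0 := Fin.ext (by simpa using hk)
  rw [hu, hs, hj, h0] at h
  simpa using h.symm

/-- A highest weight vector is determined by its components at `(0, 0)` and `(0, 1)`. -/
lemma highest_eq_zero (hn : 1 ≤ n) (hu : Matrix.toEuclideanLin (totalRaise n) u = 0)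
    (h0 : u (0, 0) = 0) (h1 : u (0, (⟨0, hn⟩ : Fin n).succ) = 0) : u = 0 := by
  ext ⟨a, b⟩
  have hone := highest_one_zero hu ⟨0, hn⟩ rfl h1
  induction b using Fin.cases with
  | zero => fin_cases a <;> simpa
  | succ k =>
    fin_cases a
    · by_cases hk : (k : ℕ) = 0
      · have : k = ⟨0, hn⟩ := Fin.ext hk
        rw [this]
        exact h1
      · exact highest_zero_succ hu k hk
    · exact highest_one_succ hu k

/-- Only `F_z² + F_z` survives in `totalSq_eq`, and it is diagonal, so Casimir eigenvalues can be
compared coordinate by coordinate. -/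
lemma highest_totalSq (hu : Matrix.toEuclideanLin (totalRaise n) u = 0) (i : Idx n) :
    Matrix.toEuclideanLin (totalSq n) u i = (weight n i * (weight n i + 1) : ℝ) * u i := by
  rw [totalSq_eq, map_add, map_add, LinearMap.add_apply, LinearMap.add_apply,
    toEuclideanLin_mul_apply, hu, map_zero, zero_add, toEuclideanLin_mul_apply,
    totalZ_eq_diagonal]
  simp only [Matrix.toLpLin_apply, Matrix.mulVec_diagonal, PiLp.add_apply]
  push_cast
  ring

end Highest

lemma weight_zero_zero (n : ℕ) : weight n (0, 0) = upperF n := by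
  simp [weight, magnetic, upperF, add_comm]

lemma weight_zero_one (n : ℕ) (hn : 1 ≤ n) :
    weight n (0, (⟨0, hn⟩ : Fin n).succ) = lowerF n := by
  simp [weight, magnetic, lowerF]
  ring

lemma weight_one_zero (n : ℕ) : weight n (1, 0) = lowerF n := by
  simp [weight, magnetic, lowerF]
  ring

lemma upper_casimir_ne_lower (n : ℕ) :
    ((upperF n * (upperF n + 1) : ℝ) : ℂ) ≠ ((lowerF n * (lowerF n + 1) : ℝ) : ℂ) := by
  rw [Ne, Complex.ofReal_inj]
  have h : upperF n * (upperF n + 1) - lowerF n * (lowerF n + 1) = n + 1 := by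
    unfold upperF lowerF
    ring
  have : (0 : ℝ) < n + 1 := by positivity
  intro h'
  linarith

/-! ### Irreducibility of the manifolds -/

lemma mem_manifold_iff (n : ℕ) (f : ℝ) (v : EuclideanSpace ℂ (Idx n)) :
    v ∈ manifold n f ↔
      Matrix.toEuclideanLin (totalSq n) v = ((f * (f + 1) : ℝ) : ℂ) • v :=
  Module.End.mem_eigenspace_iff

lemma manifold_invariant (n : ℕ) (f : ℝ) {A : Op n} (hA : Commute A (totalSq n))
    {v : EuclideanSpace ℂ (Idx n)} (hv : v ∈ manifold n f) :
    Matrix.toEuclideanLin A v ∈ manifold n f := by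
  rw [mem_manifold_iff] at hv ⊢
  rw [← toEuclideanLin_mul_apply, ← hA.eq, toEuclideanLin_mul_apply, hv, map_smul]

lemma orthogonal_invariant {ι : Type*} [Fintype ι] [DecidableEq ι] {A : Matrix ι ι ℂ}
    (hA : Aᴴ = A) {U : Submodule ℂ (EuclideanSpace ℂ ι)}
    (h : ∀ v ∈ U, Matrix.toEuclideanLin A v ∈ U) {w : EuclideanSpace ℂ ι} (hw : w ∈ Uᗮ) :
    Matrix.toEuclideanLin A w ∈ Uᗮ := by
  rw [Submodule.mem_orthogonal] at hw ⊢
  intro v hv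
  have := inner_toEuclideanLin A v w
  rw [hA] at this
  rw [← this]
  exact hw _ (h v hv)

lemma totalRaise_invariant {n : ℕ} {U : Submodule ℂ (EuclideanSpace ℂ (Idx n))}
    (hX : ∀ v ∈ U, Matrix.toEuclideanLin (totalX n) v ∈ U)
    (hY : ∀ v ∈ U, Matrix.toEuclideanLin (totalY n) v ∈ U) {v : EuclideanSpace ℂ (Idx n)}
    (hv : v ∈ U) : Matrix.toEuclideanLin (totalRaise n) v ∈ U := by
  rw [totalRaise_eq, map_add, map_smul, LinearMap.add_apply, LinearMap.smul_apply]
  exact U.add_mem (hX v hv) (U.smul_mem _ (hY v hv))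

/-- At `(0, 1)` the Casimir multiplies by the lower eigenvalue, while `u` has the upper one, so this
coordinate vanishes too. `highest_lower` is the mirror image. -/
lemma highest_upper {n : ℕ} (hn : 1 ≤ n) {u : EuclideanSpace ℂ (Idx n)}
    (hu : Matrix.toEuclideanLin (totalRaise n) u = 0) (hm : u ∈ manifold n (upperF n))
    (h0 : u (0, 0) = 0) : u = 0 := by
  refine highest_eq_zero hn hu h0 ?_
  have h := highest_totalSq hu (0, (⟨0, hn⟩ : Fin n).succ)
  rw [(mem_manifold_iff n _ u).mp hm, weight_zero_one, PiLp.smul_apply, smul_eq_mul] at h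
  by_contra hne
  exact upper_casimir_ne_lower n (mul_right_cancel₀ hne h)

lemma highest_lower {n : ℕ} (hn : 1 ≤ n) {u : EuclideanSpace ℂ (Idx n)}
    (hu : Matrix.toEuclideanLin (totalRaise n) u = 0) (hm : u ∈ manifold n (lowerF n))
    (h0 : u (0, (⟨0, hn⟩ : Fin n).succ) = 0) : u = 0 := by
  refine highest_eq_zero hn hu ?_ h0
  have h := highest_totalSq hu (0, 0)
  rw [(mem_manifold_iff n _ u).mp hm, weight_zero_zero, PiLp.smul_apply, smul_eq_mul] at h
  by_contra hne
  exact upper_casimir_ne_lower n (mul_right_cancel₀ hne h).symm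

/-- If the highest weight vectors of the manifold `f` are determined by one component, then the
manifold is irreducible under `F_x` and `F_y`. -/
lemma irreducible_of_highest {n : ℕ} {f : ℝ} (i : Idx n)
    (hi : ∀ u : EuclideanSpace ℂ (Idx n), Matrix.toEuclideanLin (totalRaise n) u = 0 →
      u ∈ manifold n f → u i = 0 → u = 0)
    {U : Submodule ℂ (EuclideanSpace ℂ (Idx n))} (hUf : U ≤ manifold n f) (hU : U ≠ ⊥)
    (hX : ∀ v ∈ U, Matrix.toEuclideanLin (totalX n) v ∈ U)
    (hY : ∀ v ∈ U, Matrix.toEuclideanLin (totalY n) v ∈ U) : U = manifold n f := by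
  have hsup := Submodule.sup_orthogonal_inf_of_hasOrthogonalProjection hUf
  suffices h : Uᗮ ⊓ manifold n f = ⊥ by rwa [h, sup_bot_eq] at hsup
  by_contra hne
  obtain ⟨u, huU, hu0, hu⟩ := exists_highest n U hU fun v => totalRaise_invariant hX hY
  obtain ⟨w, ⟨hwU, hwf⟩, hw0, hw⟩ := exists_highest n _ hne fun v =>
    totalRaise_invariant (U := Uᗮ ⊓ manifold n f)
      (fun v hv => ⟨orthogonal_invariant (totalX_conjTranspose n) hX hv.1,
        manifold_invariant n f (totalX_commute_totalSq n) hv.2⟩)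
      (fun v hv => ⟨orthogonal_invariant (totalY_conjTranspose n) hY hv.1,
        manifold_invariant n f (totalY_commute_totalSq n) hv.2⟩)
  -- The combination is chosen to cancel coordinate `i`. Its inner product with `u` then reads `w i
  -- * ⟨u, u⟩ = 0`, since `w` is orthogonal to `u`.
  have hz : w i • u - u i • w = 0 := by
    refine hi _ ?_ ?_ ?_
    · rw [map_sub, map_smul, map_smul, hu, hw]
      simp
    · exact sub_mem (Submodule.smul_mem _ _ (hUf huU)) (Submodule.smul_mem _ _ hwf)
    · simp [mul_comm]
  have hin := congrArg (inner ℂ u) hz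
  rw [inner_sub_right, inner_smul_right, inner_smul_right,
    (Submodule.mem_orthogonal _ _).mp hwU u huU, mul_zero, sub_zero, inner_zero_right,
    mul_eq_zero] at hin
  rcases hin with h | h
  · exact hw0 (hi w hw hwf h)
  · exact hu0 (inner_self_eq_zero.mp h)

lemma manifold_upper_irreducible {n : ℕ} (hn : 1 ≤ n)
    {U : Submodule ℂ (EuclideanSpace ℂ (Idx n))} (hUf : U ≤ manifold n (upperF n)) (hU : U ≠ ⊥)
    (hX : ∀ v ∈ U, Matrix.toEuclideanLin (totalX n) v ∈ U)
    (hY : ∀ v ∈ U, Matrix.toEuclideanLin (totalY n) v ∈ U) : U = manifold n (upperF n) :=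
  irreducible_of_highest (0, 0) (fun _ => highest_upper hn) hUf hU hX hY

lemma manifold_lower_irreducible {n : ℕ} (hn : 1 ≤ n)
    {U : Submodule ℂ (EuclideanSpace ℂ (Idx n))} (hUf : U ≤ manifold n (lowerF n)) (hU : U ≠ ⊥)
    (hX : ∀ v ∈ U, Matrix.toEuclideanLin (totalX n) v ∈ U)
    (hY : ∀ v ∈ U, Matrix.toEuclideanLin (totalY n) v ∈ U) : U = manifold n (lowerF n) :=
  irreducible_of_highest (0, (⟨0, hn⟩ : Fin n).succ) (fun _ => highest_lower hn) hUf hU hX hY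

/-! ### The two manifolds span the whole space -/

lemma inner_manifold_eq_zero {n : ℕ} {u v : EuclideanSpace ℂ (Idx n)}
    (hu : u ∈ manifold n (upperF n)) (hv : v ∈ manifold n (lowerF n)) : inner ℂ u v = 0 := by
  rw [mem_manifold_iff] at hu hv
  have h := inner_toEuclideanLin (totalSq n) u v
  rw [totalSq_conjTranspose, hu, hv, inner_smul_left, inner_smul_right, Complex.conj_ofReal] at h
  by_contra hne
  exact upper_casimir_ne_lower n (mul_right_cancel₀ hne h)

/-- A highest weight vector is supported on `(0, 0)`, of weight `F_+`, and on `(0, 1)`, `(1, 0)`, of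
weight `F_-`. -/
lemma highest_casimir_split {n : ℕ} {u : EuclideanSpace ℂ (Idx n)}
    (hu : Matrix.toEuclideanLin (totalRaise n) u = 0) (i : Idx n) :
    (((weight n i * (weight n i + 1) : ℝ) : ℂ) - (lowerF n * (lowerF n + 1) : ℝ)) *
      ((((weight n i * (weight n i + 1) : ℝ) : ℂ) - (upperF n * (upperF n + 1) : ℝ)) * u i) =
      0 := by
  obtain ⟨a, b⟩ := i
  induction b using Fin.cases with
  | zero =>
    fin_cases a
    · simp only [Fin.zero_eta, weight_zero_zero, sub_self, zero_mul, mul_zero]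
    · simp only [Fin.mk_one, weight_one_zero, sub_self, zero_mul]
  | succ k =>
    fin_cases a
    · by_cases hk : (k : ℕ) = 0
      · have : k = ⟨0, hk ▸ k.isLt⟩ := Fin.ext hk
        rw [this]
        simp only [Fin.zero_eta, weight_zero_one, sub_self, zero_mul]
      · simp [highest_zero_succ hu k hk]
    · simp [highest_one_succ hu k]

lemma manifold_sup_eq_top (n : ℕ) : manifold n (upperF n) ⊔ manifold n (lowerF n) = ⊤ := by
  rw [← Submodule.orthogonal_eq_bot_iff]
  by_contra hne
  have hinv : ∀ A : Op n, Commute A (totalSq n) →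
      ∀ v ∈ manifold n (upperF n) ⊔ manifold n (lowerF n),
        Matrix.toEuclideanLin A v ∈ manifold n (upperF n) ⊔ manifold n (lowerF n) := by
    intro A hA v hv
    obtain ⟨x, hx, y, hy, rfl⟩ := Submodule.mem_sup.mp hv
    rw [map_add]
    exact Submodule.add_mem_sup (manifold_invariant n _ hA hx) (manifold_invariant n _ hA hy)
  obtain ⟨u, huW, hu0, hu⟩ := exists_highest n _ hne fun v =>
    totalRaise_invariant
      (fun v hv => orthogonal_invariant (totalX_conjTranspose n)
        (hinv _ (totalX_commute_totalSq n)) hv)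
      (fun v hv => orthogonal_invariant (totalY_conjTranspose n)
        (hinv _ (totalY_commute_totalSq n)) hv)
  have hdisj : ∀ x ∈ (manifold n (upperF n) ⊔ manifold n (lowerF n))ᗮ,
      x ∈ manifold n (upperF n) ⊔ manifold n (lowerF n) → x = 0 := fun x hx hx' =>
    inner_self_eq_zero.mp ((Submodule.mem_orthogonal _ _).mp hx x hx')
  -- The product of the two Casimir factors kills `u`, so `x` lies in the lower manifold; being also
  -- orthogonal to it, `x` is zero. This puts `u` in the upper manifold, a contradiction.
  set x := Matrix.toEuclideanLin (totalSq n) u - ((upperF n * (upperF n + 1) : ℝ) : ℂ) • u with hx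
  have hxW : x ∈ (manifold n (upperF n) ⊔ manifold n (lowerF n))ᗮ :=
    sub_mem (orthogonal_invariant (totalSq_conjTranspose n) (hinv _ (Commute.refl _)) huW)
      (Submodule.smul_mem _ _ huW)
  have hxR : Matrix.toEuclideanLin (totalRaise n) x = 0 := by
    rw [hx, map_sub, map_smul, ← toEuclideanLin_mul_apply, (totalRaise_commute_totalSq n).eq,
      toEuclideanLin_mul_apply, hu]
    simp
  have hxl : x ∈ manifold n (lowerF n) := by
    rw [mem_manifold_iff]
    ext i
    have h := highest_casimir_split hu i
    have hxi : x i = (((weight n i * (weight n i + 1) : ℝ) : ℂ) -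
        (upperF n * (upperF n + 1) : ℝ)) * u i := by
      rw [hx, PiLp.sub_apply, highest_totalSq hu, PiLp.smul_apply, smul_eq_mul, sub_mul]
    rw [highest_totalSq hxR, PiLp.smul_apply, smul_eq_mul]
    rw [← hxi, sub_mul] at h
    exact sub_eq_zero.mp h
  have hx0 := hdisj x hxW (Submodule.mem_sup_right hxl)
  exact hu0 (hdisj u huW (Submodule.mem_sup_left
    ((mem_manifold_iff n _ u).mpr (sub_eq_zero.mp hx0))))

/-! ### The projections -/

lemma toEuclideanLin_manifoldProj (n : ℕ) (f : ℝ) (v : EuclideanSpace ℂ (Idx n)) :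
    Matrix.toEuclideanLin (manifoldProj n f) v = (manifold n f).starProjection v := by
  rw [← Matrix.coe_toEuclideanCLM_eq_toEuclideanLin, manifoldProj]
  simp

lemma manifoldProj_conjTranspose (n : ℕ) (f : ℝ) : (manifoldProj n f)ᴴ = manifoldProj n f := by
  apply Matrix.toEuclideanLin.injective
  refine LinearMap.ext fun v => ext_inner_left ℂ fun u => ?_
  rw [← inner_toEuclideanLin, toEuclideanLin_manifoldProj, toEuclideanLin_manifoldProj,
    Submodule.inner_starProjection_left_eq_right]

lemma manifoldProj_mem (n : ℕ) (f : ℝ) (v : EuclideanSpace ℂ (Idx n)) :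
    Matrix.toEuclideanLin (manifoldProj n f) v ∈ manifold n f := by
  rw [toEuclideanLin_manifoldProj]
  exact Submodule.starProjection_apply_mem _ _

lemma manifoldProj_of_mem {n : ℕ} {f : ℝ} {v : EuclideanSpace ℂ (Idx n)}
    (hv : v ∈ manifold n f) : Matrix.toEuclideanLin (manifoldProj n f) v = v := by
  rw [toEuclideanLin_manifoldProj]
  exact Submodule.starProjection_eq_self_iff.mpr hv

lemma manifoldProj_upper_of_lower {n : ℕ} {v : EuclideanSpace ℂ (Idx n)}
    (hv : v ∈ manifold n (lowerF n)) :
    Matrix.toEuclideanLin (manifoldProj n (upperF n)) v = 0 := by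
  rw [toEuclideanLin_manifoldProj, Submodule.starProjection_apply_eq_zero_iff,
    Submodule.mem_orthogonal]
  exact fun u hu => inner_manifold_eq_zero hu hv

lemma manifoldProj_lower_of_upper {n : ℕ} {v : EuclideanSpace ℂ (Idx n)}
    (hv : v ∈ manifold n (upperF n)) :
    Matrix.toEuclideanLin (manifoldProj n (lowerF n)) v = 0 := by
  rw [toEuclideanLin_manifoldProj, Submodule.starProjection_apply_eq_zero_iff,
    Submodule.mem_orthogonal]
  exact fun u hu => inner_eq_zero_symm.mp (inner_manifold_eq_zero hv hu)

lemma manifoldProj_add (n : ℕ) :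
    manifoldProj n (upperF n) + manifoldProj n (lowerF n) = 1 := by
  apply Matrix.toEuclideanLin.injective
  ext1 v
  obtain ⟨x, hx, y, hy, rfl⟩ := Submodule.mem_sup.mp
    (manifold_sup_eq_top n ▸ Submodule.mem_top (x := v))
  rw [map_add Matrix.toEuclideanLin, LinearMap.add_apply, map_add, map_add,
    manifoldProj_of_mem hx,
    manifoldProj_of_mem hy, manifoldProj_upper_of_lower hy, manifoldProj_lower_of_upper hx]
  simp

lemma manifoldProj_mul_self (n : ℕ) (f : ℝ) :
    manifoldProj n f * manifoldProj n f = manifoldProj n f := by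
  apply Matrix.toEuclideanLin.injective
  ext1 v
  rw [toEuclideanLin_mul_apply, manifoldProj_of_mem (manifoldProj_mem n f v)]

/-- Invariance of the manifold gives `PAP = AP`; the adjoint of this is `PAP = PA`. -/
lemma manifoldProj_commute {n : ℕ} (f : ℝ) {A : Op n} (hA : Commute A (totalSq n))
    (hA' : Aᴴ = A) : Commute (manifoldProj n f) A := by
  have h : manifoldProj n f * A * manifoldProj n f = A * manifoldProj n f := by
    apply Matrix.toEuclideanLin.injective
    ext1 v
    rw [mul_assoc, toEuclideanLin_mul_apply, manifoldProj_of_mem]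
    rw [toEuclideanLin_mul_apply]
    exact manifold_invariant n f hA (manifoldProj_mem n f v)
  have h' := congrArg Matrix.conjTranspose h
  simp only [Matrix.conjTranspose_mul, manifoldProj_conjTranspose, hA'] at h'
  rw [← mul_assoc] at h'
  exact h'.symm.trans h

/-! ### Complexification -/

section Complexify

variable {ι : Type} [Fintype ι] [DecidableEq ι] (L : LieSubalgebra ℝ (Matrix ι ι ℂ))

/-- The complexification `L + i L` of a real Lie algebra `L` of skew-Hermitian matrices. -/
def complexified : Submodule ℂ (Matrix ι ι ℂ) where
  carrier := {X | X - Xᴴ ∈ L ∧ Complex.I • (X + Xᴴ) ∈ L}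
  add_mem' := by
    rintro X Y ⟨hX, hX'⟩ ⟨hY, hY'⟩
    refine ⟨?_, ?_⟩
    · have : X + Y - (X + Y)ᴴ = (X - Xᴴ) + (Y - Yᴴ) := by
        rw [Matrix.conjTranspose_add]
        abel
      rw [this]
      exact L.add_mem hX hY
    · have : Complex.I • (X + Y + (X + Y)ᴴ) =
          Complex.I • (X + Xᴴ) + Complex.I • (Y + Yᴴ) := by
        rw [Matrix.conjTranspose_add]
        module
      rw [this]
      exact L.add_mem hX' hY'
  zero_mem' := by simp
  smul_mem' := by
    rintro c X ⟨hX, hX'⟩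
    have hc : c = (c.re : ℂ) + c.im * Complex.I := (Complex.re_add_im c).symm
    have hs : star c = (c.re : ℂ) - c.im * Complex.I := by
      rw [RCLike.star_def]
      apply Complex.ext <;> simp
    have hR : ∀ (r : ℝ) (A : Matrix ι ι ℂ), r • A = (r : ℂ) • A := fun r A => by
      ext i j
      simp
    refine ⟨?_, ?_⟩
    · have : c • X - (c • X)ᴴ = c.re • (X - Xᴴ) + c.im • (Complex.I • (X + Xᴴ)) := by
        rw [Matrix.conjTranspose_smul, hs, hR, hR]
        nth_rewrite 1 [hc]
        module
      rw [this]
      exact L.add_mem (L.smul_mem _ hX) (L.smul_mem _ hX')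
    · have : Complex.I • (c • X + (c • X)ᴴ) =
          c.re • (Complex.I • (X + Xᴴ)) - c.im • (X - Xᴴ) := by
        rw [Matrix.conjTranspose_smul, hs, hR, hR]
        nth_rewrite 1 [hc]
        have hI : Complex.I • (c.im * Complex.I) • (X - Xᴴ) = -((c.im : ℂ) • (X - Xᴴ)) := by
          rw [smul_smul, ← neg_smul]
          congr 1
          linear_combination (c.im : ℂ) * Complex.I_mul_I
        rw [sub_eq_add_neg (_ • _ • (X + Xᴴ)), ← hI]
        module
      rw [this]
      exact L.sub_mem (L.smul_mem _ hX') (L.smul_mem _ hX)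

variable {L}

lemma mem_complexified_iff {X : Matrix ι ι ℂ} :
    X ∈ complexified L ↔ X - Xᴴ ∈ L ∧ Complex.I • (X + Xᴴ) ∈ L := Iff.rfl

lemma conjTranspose_mem_complexified {X : Matrix ι ι ℂ} (hX : X ∈ complexified L) :
    Xᴴ ∈ complexified L := by
  rw [mem_complexified_iff] at hX ⊢
  rw [Matrix.conjTranspose_conjTranspose, ← neg_sub, add_comm]
  exact ⟨L.neg_mem hX.1, hX.2⟩

lemma mem_of_mem_complexified {X : Matrix ι ι ℂ} (hX : X ∈ complexified L) (hs : Xᴴ = -X) :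
    X ∈ L := by
  have h := L.smul_mem (1 / 2 : ℝ) hX.1
  rw [hs] at h
  convert h using 1
  module

lemma mem_complexified_of_hermitian {X : Matrix ι ι ℂ} (hX : -Complex.I • X ∈ L) (hs : Xᴴ = X) :
    X ∈ complexified L := by
  rw [mem_complexified_iff, hs, sub_self]
  refine ⟨L.zero_mem, ?_⟩
  have h := L.smul_mem (-2 : ℝ) hX
  convert h using 1
  module

/-- Write `X = (A - iB)/2` and `Y = (C - iD)/2` with `A, B, C, D` skew-Hermitian in `L`. The two
components of `[X, Y]` are `([A, C] - [B, D])/2` and `([A, D] + [B, C])/2`. -/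
lemma commutator_mem_complexified {X Y : Matrix ι ι ℂ} (hX : X ∈ complexified L)
    (hY : Y ∈ complexified L) : X * Y - Y * X ∈ complexified L := by
  obtain ⟨hA, hB⟩ := hX
  obtain ⟨hC, hD⟩ := hY
  have hAC := L.lie_mem hA hC
  have hBD := L.lie_mem hB hD
  have hAD := L.lie_mem hA hD
  have hBC := L.lie_mem hB hC
  rw [Ring.lie_def] at hAC hBD hAD hBC
  refine ⟨?_, ?_⟩
  · convert L.smul_mem (1 / 2 : ℝ) (L.sub_mem hAC hBD) using 1
    simp only [Matrix.conjTranspose_sub, Matrix.conjTranspose_mul, smul_mul_assoc, mul_smul_comm,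
      smul_smul, smul_add, smul_sub, Complex.I_mul_I, mul_add, add_mul, mul_sub, sub_mul]
    module
  · convert L.smul_mem (1 / 2 : ℝ) (L.add_mem hAD hBC) using 1
    simp only [Matrix.conjTranspose_sub, Matrix.conjTranspose_mul, smul_mul_assoc, mul_smul_comm,
      mul_add, add_mul, mul_sub, sub_mul]
    module

end Complexify

/-! ### Rank one operators -/

section KetBra

variable {n : ℕ}

lemma conjTranspose_ketBra (u v : EuclideanSpace ℂ (Idx n)) : (ketBra u v)ᴴ = ketBra v u := by
  rw [ketBra, ketBra, Matrix.conjTranspose_vecMulVec, star_star]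

lemma mul_ketBra (A : Op n) (u v : EuclideanSpace ℂ (Idx n)) :
    A * ketBra u v = ketBra (Matrix.toEuclideanLin A u) v := by
  rw [ketBra, ketBra, Matrix.mul_vecMulVec, Matrix.toLpLin_apply]

lemma ketBra_mul (A : Op n) (u v : EuclideanSpace ℂ (Idx n)) :
    ketBra u v * A = ketBra u (Matrix.toEuclideanLin Aᴴ v) := by
  rw [ketBra, ketBra, Matrix.vecMulVec_mul, Matrix.toLpLin_apply, Matrix.star_mulVec,
    Matrix.conjTranspose_conjTranspose]

lemma ketBra_mul_ketBra (a b c d : EuclideanSpace ℂ (Idx n)) :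
    ketBra a b * ketBra c d = (inner ℂ b c : ℂ) • ketBra a d := by
  ext i j
  rw [ketBra, ketBra, ketBra, Matrix.vecMulVec_mul_vecMulVec, Matrix.smul_apply,
    EuclideanSpace.inner_eq_star_dotProduct, dotProduct_comm]
  simp only [Matrix.vecMulVec_apply, Pi.smul_apply, smul_eq_mul]
  ring

lemma trace_ketBra (u v : EuclideanSpace ℂ (Idx n)) : (ketBra u v).trace = inner ℂ v u := by
  rw [ketBra, Matrix.trace_vecMulVec, EuclideanSpace.inner_eq_star_dotProduct]

lemma ketBra_add_left (u u' v : EuclideanSpace ℂ (Idx n)) :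
    ketBra (u + u') v = ketBra u v + ketBra u' v := by
  ext i j
  simp [ketBra, Matrix.vecMulVec_apply, add_mul]

lemma ketBra_smul_left (c : ℂ) (u v : EuclideanSpace ℂ (Idx n)) :
    ketBra (c • u) v = c • ketBra u v := by
  ext i j
  simp [ketBra, Matrix.vecMulVec_apply, mul_assoc]

lemma ketBra_add_right (u v v' : EuclideanSpace ℂ (Idx n)) :
    ketBra u (v + v') = ketBra u v + ketBra u v' := by
  ext i j
  simp [ketBra, Matrix.vecMulVec_apply, mul_add]

lemma ketBra_smul_right (c : ℂ) (u v : EuclideanSpace ℂ (Idx n)) :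
    ketBra u (c • v) = star c • ketBra u v := by
  ext i j
  simp [ketBra, Matrix.vecMulVec_apply, mul_left_comm]

lemma ketBra_zero_left (v : EuclideanSpace ℂ (Idx n)) : ketBra 0 v = 0 := by
  ext i j
  simp [ketBra, Matrix.vecMulVec_apply]

lemma ketBra_zero_right (u : EuclideanSpace ℂ (Idx n)) : ketBra u 0 = 0 := by
  ext i j
  simp [ketBra, Matrix.vecMulVec_apply]

/-- The rank one operators span all operators. -/
lemma mem_of_ketBra_mem (T : Submodule ℂ (Op n))
    (h : ∀ u v : EuclideanSpace ℂ (Idx n), ketBra u v ∈ T) (X : Op n) : X ∈ T := by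
  rw [Matrix.matrix_eq_sum_single X]
  refine T.sum_mem fun i _ => T.sum_mem fun j _ => ?_
  have : Matrix.single i j (X i j) =
      X i j • ketBra (EuclideanSpace.single i 1) (EuclideanSpace.single j 1) := by
    ext a b
    simp only [ketBra, Matrix.smul_apply, Matrix.vecMulVec_apply, Matrix.single_apply,
      PiLp.ofLp_single, Pi.star_apply, Pi.single_apply, smul_eq_mul, eq_comm (a := a),
      eq_comm (a := b), ite_and]
    split_ifs <;> simp
  rw [this]
  exact T.smul_mem _ (h _ _)

end KetBra

/-! ### Controllability -/

section Control

variable {n : ℕ}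

lemma projected_conjTranspose (f : ℝ) {A : Op n} (hA : Aᴴ = A) :
    (projected n f A)ᴴ = projected n f A := by
  simp only [projected, Matrix.conjTranspose_mul, manifoldProj_conjTranspose, hA, mul_assoc]

lemma projected_of_mem {f : ℝ} {A : Op n} (hA : Commute A (totalSq n))
    {v : EuclideanSpace ℂ (Idx n)} (hv : v ∈ manifold n f) :
    Matrix.toEuclideanLin (projected n f A) v = Matrix.toEuclideanLin A v := by
  rw [projected, toEuclideanLin_mul_apply, manifoldProj_of_mem hv, toEuclideanLin_mul_apply,
    manifoldProj_of_mem (manifold_invariant n f hA hv)]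

lemma projected_upper_of_lower (A : Op n) {v : EuclideanSpace ℂ (Idx n)}
    (hv : v ∈ manifold n (lowerF n)) :
    Matrix.toEuclideanLin (projected n (upperF n) A) v = 0 := by
  rw [projected, toEuclideanLin_mul_apply, manifoldProj_upper_of_lower hv, map_zero]

lemma projected_lower_of_upper (A : Op n) {v : EuclideanSpace ℂ (Idx n)}
    (hv : v ∈ manifold n (upperF n)) :
    Matrix.toEuclideanLin (projected n (lowerF n) A) v = 0 := by
  rw [projected, toEuclideanLin_mul_apply, manifoldProj_lower_of_upper hv, map_zero]

variable {L : LieSubalgebra ℝ (Op n)} {φ ψ : EuclideanSpace ℂ (Idx n)}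

/-- The projected operator kills `v`, so its commutator with `|u⟩⟨v|` is `|A u⟩⟨v|`. For the bra,
the commutator is taken in the opposite order to avoid a sign. -/
lemma ketBra_raise_left_mem {A : Op n} (hA : Commute A (totalSq n)) (hA' : Aᴴ = A)
    (hL : projected n (upperF n) A ∈ complexified L) {u v : EuclideanSpace ℂ (Idx n)}
    (hu : u ∈ manifold n (upperF n)) (hv : v ∈ manifold n (lowerF n))
    (h : ketBra u v ∈ complexified L) :
    ketBra (Matrix.toEuclideanLin A u) v ∈ complexified L := by
  have := commutator_mem_complexified hL h
  rwa [mul_ketBra, ketBra_mul, projected_conjTranspose _ hA', projected_of_mem hA hu,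
    projected_upper_of_lower A hv, ketBra_zero_right, sub_zero] at this

lemma ketBra_raise_right_mem {A : Op n} (hA : Commute A (totalSq n)) (hA' : Aᴴ = A)
    (hL : projected n (lowerF n) A ∈ complexified L) {u v : EuclideanSpace ℂ (Idx n)}
    (hu : u ∈ manifold n (upperF n)) (hv : v ∈ manifold n (lowerF n))
    (h : ketBra u v ∈ complexified L) :
    ketBra u (Matrix.toEuclideanLin A v) ∈ complexified L := by
  have := commutator_mem_complexified h hL
  rwa [mul_ketBra, ketBra_mul, projected_conjTranspose _ hA', projected_of_mem hA hv,
    projected_lower_of_upper A hu, ketBra_zero_left, sub_zero] at this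

/-- The orbit of a single transition `|φ⟩⟨ψ|` contains all transitions between the manifolds. -/
lemma ketBra_upper_lower_mem (hn : 1 ≤ n)
    (hXu : projected n (upperF n) (totalX n) ∈ complexified L)
    (hYu : projected n (upperF n) (totalY n) ∈ complexified L)
    (hXl : projected n (lowerF n) (totalX n) ∈ complexified L)
    (hYl : projected n (lowerF n) (totalY n) ∈ complexified L)
    (hφ : φ ∈ manifold n (upperF n)) (hφ0 : φ ≠ 0)
    (hψ : ψ ∈ manifold n (lowerF n)) (hψ0 : ψ ≠ 0) (h : ketBra φ ψ ∈ complexified L)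
    {a b : EuclideanSpace ℂ (Idx n)} (ha : a ∈ manifold n (upperF n))
    (hb : b ∈ manifold n (lowerF n)) : ketBra a b ∈ complexified L := by
  have h1 : ∀ a ∈ manifold n (upperF n), ketBra a ψ ∈ complexified L := by
    let U : Submodule ℂ (EuclideanSpace ℂ (Idx n)) :=
      { carrier := {u | u ∈ manifold n (upperF n) ∧ ketBra u ψ ∈ complexified L}
        add_mem' := fun hu hv => ⟨add_mem hu.1 hv.1, by
          rw [ketBra_add_left]; exact add_mem hu.2 hv.2⟩
        zero_mem' := ⟨zero_mem _, by rw [ketBra_zero_left]; exact zero_mem _⟩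
        smul_mem' := fun c u hu => ⟨Submodule.smul_mem _ _ hu.1, by
          rw [ketBra_smul_left]; exact Submodule.smul_mem _ _ hu.2⟩ }
    have hU : U = manifold n (upperF n) :=
      manifold_upper_irreducible hn (fun u hu => hu.1)
        (U.ne_bot_iff.mpr ⟨φ, ⟨hφ, h⟩, hφ0⟩)
        (fun u hu => ⟨manifold_invariant n _ (totalX_commute_totalSq n) hu.1,
          ketBra_raise_left_mem (totalX_commute_totalSq n) (totalX_conjTranspose n) hXu hu.1 hψ
            hu.2⟩)
        (fun u hu => ⟨manifold_invariant n _ (totalY_commute_totalSq n) hu.1,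
          ketBra_raise_left_mem (totalY_commute_totalSq n) (totalY_conjTranspose n) hYu hu.1 hψ
            hu.2⟩)
    intro a ha
    rw [← hU] at ha
    exact ha.2
  -- `v ↦ |a⟩⟨v|` is conjugate-linear, but the preimage of a complex subspace is still a complex
  -- subspace.
  let U : Submodule ℂ (EuclideanSpace ℂ (Idx n)) :=
    { carrier := {v | v ∈ manifold n (lowerF n) ∧ ketBra a v ∈ complexified L}
      add_mem' := fun hu hv => ⟨add_mem hu.1 hv.1, by
        rw [ketBra_add_right]; exact add_mem hu.2 hv.2⟩
      zero_mem' := ⟨zero_mem _, by rw [ketBra_zero_right]; exact zero_mem _⟩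
      smul_mem' := fun c u hu => ⟨Submodule.smul_mem _ _ hu.1, by
        rw [ketBra_smul_right]; exact Submodule.smul_mem _ _ hu.2⟩ }
  have hU : U = manifold n (lowerF n) :=
    manifold_lower_irreducible hn (fun v hv => hv.1)
      (U.ne_bot_iff.mpr ⟨ψ, ⟨hψ, h1 a ha⟩, hψ0⟩)
      (fun v hv => ⟨manifold_invariant n _ (totalX_commute_totalSq n) hv.1,
        ketBra_raise_right_mem (totalX_commute_totalSq n) (totalX_conjTranspose n) hXl ha hv.1
          hv.2⟩)
      (fun v hv => ⟨manifold_invariant n _ (totalY_commute_totalSq n) hv.1,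
        ketBra_raise_right_mem (totalY_commute_totalSq n) (totalY_conjTranspose n) hYl ha hv.1
          hv.2⟩)
  rw [← hU] at hb
  exact hb.2

lemma ketBra_diagonal_mem
    (h : ∀ a ∈ manifold n (upperF n), ∀ b ∈ manifold n (lowerF n), ketBra a b ∈ complexified L)
    {a a' b b' : EuclideanSpace ℂ (Idx n)} (ha : a ∈ manifold n (upperF n))
    (ha' : a' ∈ manifold n (upperF n)) (hb : b ∈ manifold n (lowerF n))
    (hb' : b' ∈ manifold n (lowerF n)) :
    (inner ℂ b b' : ℂ) • ketBra a a' - (inner ℂ a' a : ℂ) • ketBra b' b ∈ complexified L := by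
  have h' := conjTranspose_mem_complexified (h a' ha' b' hb')
  rw [conjTranspose_ketBra] at h'
  have := commutator_mem_complexified (h a ha b hb) h'
  rwa [ketBra_mul_ketBra, ketBra_mul_ketBra] at this

/-- Off-diagonal blocks are sums of transitions and their adjoints. By `ketBra_diagonal_mem`, modulo
the complexification the upper block equals its trace times `|ψ⟩⟨ψ|` and the lower block its trace
times `|φ⟩⟨φ|`. The two traces are opposite, so what remains is a multiple of `|φ⟩⟨φ| - |ψ⟩⟨ψ|`. -/
lemma traceless_mem_complexified
    (h : ∀ a ∈ manifold n (upperF n), ∀ b ∈ manifold n (lowerF n), ketBra a b ∈ complexified L)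
    (hφ : φ ∈ manifold n (upperF n)) (hφ1 : ‖φ‖ = 1)
    (hψ : ψ ∈ manifold n (lowerF n)) (hψ1 : ‖ψ‖ = 1) {X : Op n} (hX : X.trace = 0) :
    X ∈ complexified L := by
  have hφφ : (inner ℂ φ φ : ℂ) = 1 := by
    rw [inner_self_eq_norm_sq_to_K, hφ1]
    simp
  have hψψ : (inner ℂ ψ ψ : ℂ) = 1 := by
    rw [inner_self_eq_norm_sq_to_K, hψ1]
    simp
  set P := manifoldProj n (upperF n) with hP
  set Q := manifoldProj n (lowerF n) with hQ
  have hPQ : P + Q = 1 := manifoldProj_add n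
  have hoff : ∀ Y : Op n, P * Y * Q ∈ complexified L := fun Y => by
    have hY := mem_of_ketBra_mem ((complexified L).comap
      (LinearMap.mulLeft ℂ P ∘ₗ LinearMap.mulRight ℂ Q)) (fun u v => by
        rw [Submodule.mem_comap, LinearMap.comp_apply, LinearMap.mulLeft_apply,
          LinearMap.mulRight_apply, ketBra_mul, mul_ketBra, hQ, manifoldProj_conjTranspose]
        exact h _ (manifoldProj_mem _ _ _) _ (manifoldProj_mem _ _ _)) Y
    simpa [mul_assoc] using hY
  have hoff' : Q * X * P ∈ complexified L := by
    have := conjTranspose_mem_complexified (hoff Xᴴ)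
    simpa only [Matrix.conjTranspose_mul, hP, hQ, manifoldProj_conjTranspose,
      Matrix.conjTranspose_conjTranspose, mul_assoc] using this
  have hup : P * X * P - (P * X * P).trace • ketBra ψ ψ ∈ complexified L := by
    let D : Op n →ₗ[ℂ] Op n := LinearMap.mulLeft ℂ P ∘ₗ LinearMap.mulRight ℂ P
    let Φ : Op n →ₗ[ℂ] Op n := D -
      (LinearMap.toSpanSingleton ℂ (Op n) (ketBra ψ ψ)) ∘ₗ (Matrix.traceLinearMap (Idx n) ℂ ℂ) ∘ₗ D
    have hΦ : ∀ Y, Φ Y = P * Y * P - (P * Y * P).trace • ketBra ψ ψ := fun Y => by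
      simp [Φ, D, mul_assoc]
    rw [← hΦ]
    refine mem_of_ketBra_mem ((complexified L).comap Φ) (fun u v => ?_) X
    rw [Submodule.mem_comap, hΦ, mul_ketBra, ketBra_mul, trace_ketBra, hP,
      manifoldProj_conjTranspose]
    have := ketBra_diagonal_mem h (manifoldProj_mem n (upperF n) u)
      (manifoldProj_mem n (upperF n) v) hψ hψ
    rwa [hψψ, one_smul] at this
  have hlow : (Q * X * Q).trace • ketBra φ φ - Q * X * Q ∈ complexified L := by
    let D : Op n →ₗ[ℂ] Op n := LinearMap.mulLeft ℂ Q ∘ₗ LinearMap.mulRight ℂ Q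
    let Φ : Op n →ₗ[ℂ] Op n := (LinearMap.toSpanSingleton ℂ (Op n) (ketBra φ φ)) ∘ₗ
      (Matrix.traceLinearMap (Idx n) ℂ ℂ) ∘ₗ D - D
    have hΦ : ∀ Y, Φ Y = (Q * Y * Q).trace • ketBra φ φ - Q * Y * Q := fun Y => by
      simp [Φ, D, mul_assoc]
    rw [← hΦ]
    refine mem_of_ketBra_mem ((complexified L).comap Φ) (fun u v => ?_) X
    rw [Submodule.mem_comap, hΦ, mul_ketBra, ketBra_mul, trace_ketBra, hQ,
      manifoldProj_conjTranspose]
    have := ketBra_diagonal_mem h hφ hφ (manifoldProj_mem n (lowerF n) v)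
      (manifoldProj_mem n (lowerF n) u)
    rwa [hφφ, one_smul] at this
  have hd : ketBra φ φ - ketBra ψ ψ ∈ complexified L := by
    have := ketBra_diagonal_mem h hφ hφ hψ hψ
    rwa [hφφ, hψψ, one_smul, one_smul] at this
  have htr : (P * X * P).trace + (Q * X * Q).trace = 0 := by
    rw [Matrix.trace_mul_comm, Matrix.trace_mul_comm (Q * X), ← mul_assoc, ← mul_assoc,
      hP, hQ, manifoldProj_mul_self, manifoldProj_mul_self, ← Matrix.trace_add, ← add_mul,
      manifoldProj_add, one_mul, hX]
  have hdec : X = P * X * Q + Q * X * P + (P * X * P - (P * X * P).trace • ketBra ψ ψ) -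
      ((Q * X * Q).trace • ketBra φ φ - Q * X * Q) +
      (Q * X * Q).trace • (ketBra φ φ - ketBra ψ ψ) := by
    have e : X = (P + Q) * X * (P + Q) := by rw [hPQ, one_mul, mul_one]
    have e' : (P * X * P).trace = -(Q * X * Q).trace := eq_neg_of_add_eq_zero_left htr
    nth_rewrite 1 [e]
    rw [e']
    simp only [add_mul, mul_add]
    module
  rw [hdec]
  exact add_mem (sub_mem (add_mem (add_mem (hoff X) hoff') hup) hlow)
    (Submodule.smul_mem _ _ hd)

/-- The trace is `c tr(P[B, C])`, which vanishes by cyclicity because `P` commutes with `B`. -/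
lemma trace_projected_eq_zero (f : ℝ) {A B C : Op n} (hB : Commute B (totalSq n)) (hB' : Bᴴ = B)
    (c : ℂ) (hA : A = c • (B * C - C * B)) : (projected n f A).trace = 0 := by
  have hPB := (manifoldProj_commute f hB hB').eq
  rw [projected, Matrix.trace_mul_comm, ← mul_assoc, manifoldProj_mul_self, hA, mul_smul_comm,
    Matrix.trace_smul, mul_sub, ← mul_assoc, hPB, mul_assoc, Matrix.trace_sub,
    Matrix.trace_mul_comm B, mul_assoc, sub_self, smul_zero]

lemma totalX_eq_commutator (n : ℕ) :
    totalX n = -Complex.I • (totalY n * totalZ n - totalZ n * totalY n) := by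
  have h : totalY n * totalZ n - totalZ n * totalY n = -(1 / (2 * Complex.I)) •
      ((totalZ n * totalRaise n - totalRaise n * totalZ n) -
        (totalZ n * (totalRaise n)ᴴ - (totalRaise n)ᴴ * totalZ n)) := by
    rw [totalY_eq]
    simp only [smul_mul_assoc, mul_smul_comm, mul_sub, sub_mul]
    module
  rw [h, totalZ_commutator, totalZ_commutator_conjTranspose, smul_smul, sub_neg_eq_add, totalX_eq]
  congr 1
  field_simp

lemma totalY_eq_commutator (n : ℕ) :
    totalY n = Complex.I • (totalX n * totalZ n - totalZ n * totalX n) := by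
  have h : totalX n * totalZ n - totalZ n * totalX n = -(1 / 2 : ℂ) •
      ((totalZ n * totalRaise n - totalRaise n * totalZ n) +
        (totalZ n * (totalRaise n)ᴴ - (totalRaise n)ᴴ * totalZ n)) := by
    rw [totalX_eq]
    simp only [smul_mul_assoc, mul_smul_comm, mul_add, add_mul]
    module
  rw [h, totalZ_commutator, totalZ_commutator_conjTranspose, smul_smul, ← sub_eq_add_neg,
    totalY_eq]
  congr 1
  field_simp
  simp

lemma trace_projected_totalX (n : ℕ) (f : ℝ) : (projected n f (totalX n)).trace = 0 :=
  trace_projected_eq_zero f (totalY_commute_totalSq n) (totalY_conjTranspose n) _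
    (totalX_eq_commutator n)

lemma trace_projected_totalY (n : ℕ) (f : ℝ) : (projected n f (totalY n)).trace = 0 :=
  trace_projected_eq_zero f (totalX_commute_totalSq n) (totalX_conjTranspose n) _
    (totalY_eq_commutator n)

lemma pauliX_conjTranspose (φ ψ : EuclideanSpace ℂ (Idx n)) : (pauliX φ ψ)ᴴ = pauliX φ ψ := by
  rw [pauliX, Matrix.conjTranspose_add, conjTranspose_ketBra, conjTranspose_ketBra, add_comm]

lemma pauliY_conjTranspose (φ ψ : EuclideanSpace ℂ (Idx n)) : (pauliY φ ψ)ᴴ = pauliY φ ψ := by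
  rw [pauliY, Matrix.conjTranspose_add, Matrix.conjTranspose_smul, Matrix.conjTranspose_smul,
    conjTranspose_ketBra, conjTranspose_ketBra, add_comm]
  simp

lemma trace_pauliX (hφ : φ ∈ manifold n (upperF n)) (hψ : ψ ∈ manifold n (lowerF n)) :
    (pauliX φ ψ).trace = 0 := by
  rw [pauliX, Matrix.trace_add, trace_ketBra, trace_ketBra, inner_manifold_eq_zero hφ hψ,
    inner_eq_zero_symm.mp (inner_manifold_eq_zero hφ hψ), add_zero]

lemma trace_pauliY (hφ : φ ∈ manifold n (upperF n)) (hψ : ψ ∈ manifold n (lowerF n)) :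
    (pauliY φ ψ).trace = 0 := by
  rw [pauliY, Matrix.trace_add, Matrix.trace_smul, Matrix.trace_smul, trace_ketBra, trace_ketBra,
    inner_manifold_eq_zero hφ hψ, inner_eq_zero_symm.mp (inner_manifold_eq_zero hφ hψ),
    smul_zero, smul_zero, add_zero]

lemma ketBra_eq_pauli (φ ψ : EuclideanSpace ℂ (Idx n)) :
    ketBra φ ψ = (1 / 2 : ℂ) • (pauliX φ ψ + Complex.I • pauliY φ ψ) := by
  rw [pauliX, pauliY, smul_add Complex.I, smul_smul, smul_smul, mul_neg, Complex.I_mul_I]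
  module

lemma neg_I_smul_mem_su {H : Op n} (hH : Hᴴ = H) (ht : H.trace = 0) :
    -Complex.I • H ∈ su (Idx n) := by
  refine ⟨?_, ?_⟩
  · rw [Matrix.conjTranspose_smul, hH]
    simp
  · rw [Matrix.trace_smul, ht, smul_zero]

end Control

end AlkaliControl

end

open AlkaliControl in
/-- For every nuclear spin `I = n / 2 ≥ 1 / 2` and every choice of a sublevel
`|F_+, m_+⟩`, `m_+ = F_+ - k` with `0 ≤ k ≤ 2 F_+ = n + 1`, and of a sublevel
`|F_-, m_-⟩`, `m_- = F_- - l` with `0 ≤ l ≤ 2 F_- = n - 1`. -/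
theorem mainTheorem2 (n : ℕ) (hn : 1 ≤ n) (k : Fin (n + 2)) (l : Fin n)
    (φ ψ : EuclideanSpace ℂ (Idx n))
    (hφ : IsSublevel n (upperF n) (upperF n - (k : ℕ)) φ)
    (hψ : IsSublevel n (lowerF n) (lowerF n - (l : ℕ)) ψ) :
    controlAlgebra
        {projected n (upperF n) (totalX n), projected n (upperF n) (totalY n),
          projected n (lowerF n) (totalX n), projected n (lowerF n) (totalY n),
          pauliX φ ψ, pauliY φ ψ} =
      su (Idx n) := by
  have hφ0 : φ ≠ 0 := by
    rintro rfl
    simpa using hφ.norm_eq_one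
  have hψ0 : ψ ≠ 0 := by
    rintro rfl
    simpa using hψ.norm_eq_one
  have hφm := hφ.mem_manifold
  have hψm := hψ.mem_manifold
  have hX := totalX_conjTranspose n
  have hY := totalY_conjTranspose n
  apply le_antisymm
  · refine LieSubalgebra.lieSpan_le.mpr ?_
    rintro _ ⟨H, hH, rfl⟩
    simp only [Set.mem_insert_iff, Set.mem_singleton_iff] at hH
    rcases hH with rfl | rfl | rfl | rfl | rfl | rfl
    · exact neg_I_smul_mem_su (projected_conjTranspose _ hX) (trace_projected_totalX n _)
    · exact neg_I_smul_mem_su (projected_conjTranspose _ hY) (trace_projected_totalY n _)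
    · exact neg_I_smul_mem_su (projected_conjTranspose _ hX) (trace_projected_totalX n _)
    · exact neg_I_smul_mem_su (projected_conjTranspose _ hY) (trace_projected_totalY n _)
    · exact neg_I_smul_mem_su (pauliX_conjTranspose φ ψ) (trace_pauliX hφm hψm)
    · exact neg_I_smul_mem_su (pauliY_conjTranspose φ ψ) (trace_pauliY hφm hψm)
  · rintro A ⟨hA, hA'⟩
    set S : Set (Op n) := {projected n (upperF n) (totalX n), projected n (upperF n) (totalY n),
      projected n (lowerF n) (totalX n), projected n (lowerF n) (totalY n),
      pauliX φ ψ, pauliY φ ψ} with hS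
    have hgen : ∀ H ∈ S, Hᴴ = H → H ∈ complexified (controlAlgebra S) := fun H hH hH' =>
      mem_complexified_of_hermitian (LieSubalgebra.subset_lieSpan ⟨H, hH, rfl⟩) hH'
    have hket : ketBra φ ψ ∈ complexified (controlAlgebra S) := by
      rw [ketBra_eq_pauli]
      exact Submodule.smul_mem _ _ (add_mem
        (hgen _ (by simp [hS]) (pauliX_conjTranspose φ ψ))
        (Submodule.smul_mem _ _ (hgen _ (by simp [hS]) (pauliY_conjTranspose φ ψ))))
    -- Tracelessness puts `A` in the complexification; skew-Hermiticity brings it back to the real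
    -- algebra.
    refine mem_of_mem_complexified (traceless_mem_complexified (fun a ha b hb => ?_)
      hφm hφ.norm_eq_one hψm hψ.norm_eq_one hA') hA
    exact ketBra_upper_lower_mem hn
      (hgen _ (by simp [hS]) (projected_conjTranspose _ hX))
      (hgen _ (by simp [hS]) (projected_conjTranspose _ hY))
      (hgen _ (by simp [hS]) (projected_conjTranspose _ hX))
      (hgen _ (by simp [hS]) (projected_conjTranspose _ hY))
      hφm hφ0 hψm hψ0 hket ha hb
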